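/- Let $K$ be an infinite field and let $\mathfrak{f}_2$ be the free Lie algebra over $K$ on two generators. Put $\mathfrak{f}_2^{(2)}=[[\mathfrak{f}_2,\mathfrak{f}_2],[\mathfrak{f}_2,\mathfrak{f}_2]]$, $\gamma_1(\mathfrak{f}_2)=\mathfrak{f}_2$ and $\gamma_{i+1}(\mathfrak{f}_2)=[\mathfrak{f}_2,\gamma_i(\mathfrak{f}_2)]$ for $i\ge 1$. For an integer $c\ge 0$ let $$\mathfrak{m}_{2,c}=\frac{\mathfrak{f}_2}{\mathfrak{f}_2^{(2)}+\gamma_{c+1}(\mathfrak{f}_2)}$$ be the free $c$-step nilpotent metabelian Lie algebra on two generators (for $c=0$ this is the zero algebra). For a Lie algebra $\mathfrak{g}$ over $K$, let $\mathrm{Inn}(\mathfrak{g})=\{\mathrm{ad}(y) : y\in\mathfrak{g}\}$ be the Lie algebra of its inner derivations, and let $\mathrm{AID}(\mathfrak{g})$ be the Lie algebra of its almost inner derivations, that is, of the derivations $D$ of $\mathfrak{g}$ such that $D(x)\in[\mathfrak{g},x]=\{[y,x] : y\in\mathfrak{g}\}$ for all $x\in\mathfrak{g}$. Then $$\mathrm{AID}(\mathfrak{m}_{2,c})=\mathrm{Inn}(\mathfrak{m}_{2,c}).$$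 -/

import Mathlib

/-- A derivation `D` of a Lie algebra `L` is almost inner if `D x ∈ [L, x] = {[y, x] | y ∈ L}` for
every `x ∈ L`. -/
def IsAlmostInner {K L : Type*} [CommRing K] [LieRing L] [LieAlgebra K L]
    (D : LieDerivation K L L) : Prop :=
  ∀ x : L, ∃ y : L, D x = ⁅y, x⁆

/-- `AID(L)`: the Lie subalgebra of `Der(L)` formed by the almost inner derivations. -/
def AID (K L : Type*) [CommRing K] [LieRing L] [LieAlgebra K L] :
    LieSubalgebra K (LieDerivation K L L) where
  carrier := {D | IsAlmostInner D}
  zero_mem' := fun x => ⟨0, by simp⟩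
  add_mem' := by
    intro D D' hD hD' x
    obtain ⟨y, hy⟩ := hD x
    obtain ⟨y', hy'⟩ := hD' x
    exact ⟨y + y', by simp [hy, hy']⟩
  smul_mem' := by
    intro t D hD x
    obtain ⟨y, hy⟩ := hD x
    exact ⟨t • y, by simp [hy]⟩
  lie_mem' := by
    intro D D' hD hD' x
    obtain ⟨y, hy⟩ := hD x
    obtain ⟨y', hy'⟩ := hD' x
    refine ⟨D y' - D' y + ⁅y', y⁆, ?_⟩
    rw [LieDerivation.lie_apply, hy, hy', LieDerivation.apply_lie_eq_add,
      LieDerivation.apply_lie_eq_add, hy, hy', add_lie, sub_lie, lie_lie]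
    abel

/-- `Inn(L)`: the Lie subalgebra of `Der(L)` formed by the inner derivations `ad y`, `y ∈ L`. -/
def Inn (K L : Type*) [CommRing K] [LieRing L] [LieAlgebra K L] :
    LieSubalgebra K (LieDerivation K L L) :=
  (LieDerivation.ad K L).range

/-- The ideal `𝔣₂⁽²⁾ + γ_{c+1}(𝔣₂)` of the free Lie algebra `𝔣₂` on two generators.
`derivedSeries K L 2` is `[[L, L], [L, L]]`; Mathlib's lower central series starts with `L` at
index `0`, so `γ_{c+1}` is its term of index `c`. -/
noncomputable abbrev metabelianNilpotentIdeal (K : Type*) [CommRing K] (c : ℕ) :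
    LieIdeal K (FreeLieAlgebra K (Fin 2)) :=
  LieAlgebra.derivedSeries K (FreeLieAlgebra K (Fin 2)) 2 ⊔
    LieModule.lowerCentralSeries K (FreeLieAlgebra K (Fin 2)) (FreeLieAlgebra K (Fin 2)) c

/-- The free `c`-step nilpotent metabelian Lie algebra `𝔪_{2,c}` on two generators. -/
abbrev FreeMetabelianNilpotent (K : Type*) [CommRing K] (c : ℕ) : Type _ :=
  FreeLieAlgebra K (Fin 2) ⧸ metabelianNilpotentIdeal K c

/-!
Let `x`, `y` be the generators of `𝔪 = 𝔪_{2,c}`. Since `𝔪` is metabelian, `ad x` and `ad y` commute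
on `[𝔪, 𝔪]`, and `𝔪` is spanned by `x`, `y` and the monomials `(ad x)^i (ad y)^j [x, y]`
(`exists_eq_add_linearCombination_bracketMonomial`), which vanish if `i + j + 1 ≥ c`.

The other monomials are linearly independent. This is seen in a Magnus-type representation of the
free Lie algebra by affine matrices over `K[z][s]`, with `x ↦ !![s, 0; 0, 0]` and
`y ↦ !![z * s, 1; 0, 0]` (`affineRep`). It kills the second derived algebra and maps the ideal
defining `𝔪` to matrices divisible by `s ^ c` (`X_pow_dvd_shiftPart`), while the monomial with
exponents `(i, j)` has top right entry `s ^ (i + j + 1) * z ^ j` (`shiftPart_bracketMonomial`).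

An almost inner derivation `D` can be changed by an inner one so that `D x = 0` and
`D y = [u, y]` with `u` a combination of monomials. For every `t` the element
`D (x + t y) = t [u, y]` lies in `[𝔪, x + t y]`. In the representation, `ad (x + t y)` acts on
top right entries of commutators as multiplication by `s * (1 + t * z)`, so degree by degree
the entry of `u` vanishes at `z = -t⁻¹` for every `t ≠ 0`. As `K` is infinite, the entry is zero in
all degrees that matter, so that `[u, y] = 0` (`coeff_eq_zero_of_lie_smul_eq_lie_add_smul`) and
`D = 0`.
-/

open Polynomial

/-! ### Left-normed monomials in a Lie algebra generated by two elements -/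

section BracketMonomial

variable {K L : Type*} [CommRing K] [LieRing L] [LieAlgebra K L]

/-- The monomial `(ad x)^i (ad y)^j ⁅x, y⁆`, where `p = (i, j)`. -/
def bracketMonomial (K : Type*) {L : Type*} [CommRing K] [LieRing L] [LieAlgebra K L]
    (x y : L) (p : ℕ × ℕ) : L :=
  (LieAlgebra.ad K L x ^ p.1) ((LieAlgebra.ad K L y ^ p.2) ⁅x, y⁆)

theorem bracketMonomial_zero_zero (x y : L) : bracketMonomial K x y (0, 0) = ⁅x, y⁆ := by
  simp [bracketMonomial]

theorem bracketMonomial_succ_fst (x y : L) (i j : ℕ) :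
    bracketMonomial K x y (i + 1, j) = ⁅x, bracketMonomial K x y (i, j)⁆ := by
  simp only [bracketMonomial, pow_succ', Module.End.mul_apply, LieAlgebra.ad_apply]

theorem bracketMonomial_zero_succ (x y : L) (j : ℕ) :
    bracketMonomial K x y (0, j + 1) = ⁅y, bracketMonomial K x y (0, j)⁆ := by
  simp only [bracketMonomial, pow_succ', pow_zero, Module.End.mul_apply, Module.End.one_apply,
    LieAlgebra.ad_apply]

theorem map_bracketMonomial {L' : Type*} [LieRing L'] [LieAlgebra K L'] (f : L →ₗ⁅K⁆ L')
    (x y : L) (p : ℕ × ℕ) :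
    f (bracketMonomial K x y p) = bracketMonomial K (f x) (f y) p := by
  obtain ⟨i, j⟩ := p
  induction i with
  | zero =>
    induction j with
    | zero => simp only [bracketMonomial_zero_zero, LieHom.map_lie]
    | succ j ih => simp only [bracketMonomial_zero_succ, LieHom.map_lie, ih]
  | succ i ih => simp only [bracketMonomial_succ_fst, LieHom.map_lie, ih]

theorem exists_bracketMonomial_eq_lie (x y : L) (p : ℕ × ℕ) :
    ∃ a b : L, bracketMonomial K x y p = ⁅a, b⁆ := by
  obtain ⟨i, j⟩ := p
  cases i with
  | zero =>
    cases j with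
    | zero => exact ⟨_, _, bracketMonomial_zero_zero x y⟩
    | succ j => exact ⟨_, _, bracketMonomial_zero_succ x y j⟩
  | succ i => exact ⟨_, _, bracketMonomial_succ_fst x y i j⟩

theorem bracketMonomial_mem_lowerCentralSeries (x y : L) (i j : ℕ) :
    bracketMonomial K x y (i, j) ∈ LieModule.lowerCentralSeries K L L (i + j + 1) := by
  have step {k : ℕ} (a : L) {u : L} (hu : u ∈ LieModule.lowerCentralSeries K L L k) :
      ⁅a, u⁆ ∈ LieModule.lowerCentralSeries K L L (k + 1) := by
    rw [LieModule.lowerCentralSeries_succ]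
    exact LieSubmodule.lie_mem_lie (LieSubmodule.mem_top a) hu
  induction i with
  | zero =>
    induction j with
    | zero =>
      rw [bracketMonomial_zero_zero]
      exact step x (by simp)
    | succ j ih =>
      rw [bracketMonomial_zero_succ, ← add_assoc]
      exact step y ih
  | succ i ih =>
    rw [bracketMonomial_succ_fst, add_right_comm i 1 j]
    exact step x ih

/-- In a metabelian Lie algebra `ad x` and `ad y` commute on the derived algebra, so `ad y` too
acts on the monomials by shifting an exponent. -/
theorem bracketMonomial_succ_snd (hmet : ∀ a b c d : L, ⁅⁅a, b⁆, ⁅c, d⁆⁆ = 0) (x y : L) (i j : ℕ) :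
    bracketMonomial K x y (i, j + 1) = ⁅y, bracketMonomial K x y (i, j)⁆ := by
  induction i with
  | zero => exact bracketMonomial_zero_succ x y j
  | succ i ih =>
    obtain ⟨a, b, hab⟩ := exists_bracketMonomial_eq_lie (K := K) x y (i, j)
    rw [bracketMonomial_succ_fst, bracketMonomial_succ_fst, ih, leibniz_lie y x, hab, hmet,
      zero_add]

/-- A metabelian Lie algebra generated by `x` and `y` is spanned by `x`, `y` and the monomials. -/
theorem exists_eq_add_linearCombination_bracketMonomial
    (hmet : ∀ a b c d : L, ⁅⁅a, b⁆, ⁅c, d⁆⁆ = 0) {x y : L}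
    (hgen : LieSubalgebra.lieSpan K L {x, y} = ⊤) (v : L) :
    ∃ (a b : K) (f : ℕ × ℕ →₀ K),
      v = a • x + b • y + Finsupp.linearCombination K (bracketMonomial K x y) f := by
  set e := bracketMonomial K x y with he
  set T : Set L := {x, y} ∪ Set.range e with hT
  have hx : x ∈ T := by simp [hT]
  have hy : y ∈ T := by simp [hT]
  have hmem (p) : e p ∈ Submodule.span K T := Submodule.subset_span (by simp [hT])
  have hxy : ⁅x, y⁆ ∈ Submodule.span K T := by
    rw [← bracketMonomial_zero_zero (K := K)]; exact hmem _
  have hxe (p) : ⁅x, e p⁆ ∈ Submodule.span K T := by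
    rw [he, ← bracketMonomial_succ_fst]; exact hmem _
  have hye (p) : ⁅y, e p⁆ ∈ Submodule.span K T := by
    rw [he, ← bracketMonomial_succ_snd hmet]; exact hmem _
  have hlie : ∀ a ∈ T, ∀ b ∈ T, ⁅a, b⁆ ∈ Submodule.span K T := by
    rintro a ((rfl | rfl) | ⟨p, rfl⟩) b ((rfl | rfl) | ⟨q, rfl⟩)
    · simp
    · exact hxy
    · exact hxe q
    · rw [← lie_skew]; exact neg_mem hxy
    · simp
    · exact hye q
    · rw [← lie_skew]; exact neg_mem (hxe p)
    · rw [← lie_skew]; exact neg_mem (hye p)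
    · obtain ⟨a, b, h⟩ := exists_bracketMonomial_eq_lie (K := K) x y p
      obtain ⟨c, d, h'⟩ := exists_bracketMonomial_eq_lie (K := K) x y q
      rw [he, h, h', hmet]
      exact zero_mem _
  let S : LieSubalgebra K L :=
    { Submodule.span K T with
      lie_mem' := by
        intro a b ha hb
        change a ∈ Submodule.span K T at ha
        change b ∈ Submodule.span K T at hb
        change ⁅a, b⁆ ∈ Submodule.span K T
        induction ha, hb using Submodule.span_induction₂ with
        | mem_mem a b ha hb => exact hlie a ha b hb
        | zero_left => simp
        | zero_right => simp
        | add_left a b c _ _ _ h h' => rw [add_lie]; exact add_mem h h'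
        | add_right a b c _ _ _ h h' => rw [lie_add]; exact add_mem h h'
        | smul_left r a b _ _ h => rw [smul_lie]; exact Submodule.smul_mem _ _ h
        | smul_right r a b _ _ h => rw [lie_smul]; exact Submodule.smul_mem _ _ h }
  have hS : (⊤ : LieSubalgebra K L) ≤ S := by
    rw [← hgen, LieSubalgebra.lieSpan_le]
    rintro _ (rfl | rfl)
    exacts [Submodule.subset_span hx, Submodule.subset_span hy]
  have hv : v ∈ Submodule.span K T := hS (LieSubalgebra.mem_top v)
  rw [hT, Submodule.span_union, Submodule.mem_sup] at hv
  obtain ⟨u, hu, w, hw, rfl⟩ := hv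
  obtain ⟨a, b, rfl⟩ := Submodule.mem_span_pair.1 hu
  obtain ⟨f, rfl⟩ := (Finsupp.mem_span_range_iff_exists_finsupp).1 hw
  exact ⟨a, b, f, rfl⟩

end BracketMonomial

/-! ### An affine representation of the free Lie algebra on two generators -/

section AffineRep

attribute [local instance] LieRing.ofAssociativeRing

variable (K : Type*) [Field K]

/-- The representation of the free Lie algebra by matrices over `K[z][s]` with
`x ↦ !![s, 0; 0, 0]` and `y ↦ !![z * s, 1; 0, 0]`. Here `z` is the variable of the inner and `s`
that of the outer polynomial ring; the power of `s` in the top right entry records the degree. -/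
noncomputable def affineRep :
    FreeLieAlgebra K (Fin 2) →ₗ⁅K⁆ Matrix (Fin 2) (Fin 2) K[X][X] :=
  FreeLieAlgebra.lift K ![!![X, 0; 0, 0], !![C X * X, 1; 0, 0]]

/-- The top left entry of `affineRep`. -/
noncomputable def scalePart : FreeLieAlgebra K (Fin 2) →ₗ[K] K[X][X] :=
  Matrix.entryLinearMap K _ 0 0 ∘ₗ (affineRep K).toLinearMap

/-- The top right entry of `affineRep`. -/
noncomputable def shiftPart : FreeLieAlgebra K (Fin 2) →ₗ[K] K[X][X] :=
  Matrix.entryLinearMap K _ 0 1 ∘ₗ (affineRep K).toLinearMap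

variable {K}

theorem FreeLieAlgebra.lieSpan_range_of (R Y : Type*) [CommRing R] :
    LieSubalgebra.lieSpan R (FreeLieAlgebra R Y) (Set.range (FreeLieAlgebra.of R)) = ⊤ := by
  set H := LieSubalgebra.lieSpan R (FreeLieAlgebra R Y) (Set.range (FreeLieAlgebra.of R))
  let g : FreeLieAlgebra R Y →ₗ⁅R⁆ H := FreeLieAlgebra.lift R fun i =>
    ⟨FreeLieAlgebra.of R i, LieSubalgebra.subset_lieSpan ⟨i, rfl⟩⟩
  have hg : H.incl.comp g = LieHom.id :=
    FreeLieAlgebra.hom_ext fun i => by simp [g]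
  refine eq_top_iff.2 fun u _ => ?_
  have := (g u).2
  rwa [show ((g u : H) : FreeLieAlgebra R Y) = u from LieHom.congr_fun hg u] at this

theorem affineRep_of_zero :
    affineRep K (FreeLieAlgebra.of K 0) = !![X, 0; 0, 0] := by
  simp [affineRep]

theorem affineRep_of_one :
    affineRep K (FreeLieAlgebra.of K 1) = !![C X * X, 1; 0, 0] := by
  simp [affineRep]

/-- The bottom row of the representation vanishes and its top left entry is linear in `s`. -/
theorem affineRep_bounds (u : FreeLieAlgebra K (Fin 2)) :
    affineRep K u 1 0 = 0 ∧ affineRep K u 1 1 = 0 ∧ ∀ k ≠ 1, (affineRep K u 0 0).coeff k = 0 := by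
  let S : LieSubalgebra K (FreeLieAlgebra K (Fin 2)) :=
    { carrier := {u | affineRep K u 1 0 = 0 ∧ affineRep K u 1 1 = 0 ∧
        ∀ k ≠ 1, (affineRep K u 0 0).coeff k = 0}
      zero_mem' := by simp
      add_mem' := by
        rintro a b ⟨h1, h2, h3⟩ ⟨h1', h2', h3'⟩
        refine ⟨by simp [h1, h1'], by simp [h2, h2'], fun k hk => ?_⟩
        simp [h3 k hk, h3' k hk]
      smul_mem' := by
        rintro r a ⟨h1, h2, h3⟩
        refine ⟨by simp [h1], by simp [h2], fun k hk => ?_⟩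
        simp [h3 k hk]
      lie_mem' := by
        rintro a b ⟨h1, h2, h3⟩ ⟨h1', h2', h3'⟩
        refine ⟨?_, ?_, fun k hk => ?_⟩ <;>
          simp [LieRing.of_associative_ring_bracket, Matrix.mul_apply, h1, h2, h1', h2', mul_comm] }
  have hS : (⊤ : LieSubalgebra K (FreeLieAlgebra K (Fin 2))) ≤ S := by
    rw [← FreeLieAlgebra.lieSpan_range_of, LieSubalgebra.lieSpan_le]
    rintro _ ⟨i, rfl⟩
    fin_cases i
    · refine ⟨?_, ?_, fun k hk => ?_⟩
      all_goals simp +contextual [affineRep_of_zero, coeff_X, eq_comm, *]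
    · refine ⟨?_, ?_, fun k hk => ?_⟩
      all_goals simp +contextual [affineRep_of_one, coeff_X, eq_comm, *]
  exact hS (LieSubalgebra.mem_top u)

theorem coeff_scalePart (u : FreeLieAlgebra K (Fin 2)) {k : ℕ} (hk : k ≠ 1) :
    (scalePart K u).coeff k = 0 :=
  (affineRep_bounds u).2.2 k hk

theorem X_dvd_scalePart (u : FreeLieAlgebra K (Fin 2)) : X ∣ scalePart K u :=
  X_dvd_iff.2 (coeff_scalePart u zero_ne_one)

theorem scalePart_lie (u v : FreeLieAlgebra K (Fin 2)) : scalePart K ⁅u, v⁆ = 0 := by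
  have hu := affineRep_bounds u
  have hv := affineRep_bounds v
  simp [scalePart, LieRing.of_associative_ring_bracket, Matrix.mul_apply, hu, hv, mul_comm]

theorem shiftPart_lie (u v : FreeLieAlgebra K (Fin 2)) :
    shiftPart K ⁅u, v⁆ = scalePart K u * shiftPart K v - scalePart K v * shiftPart K u := by
  have hu := affineRep_bounds u
  have hv := affineRep_bounds v
  simp [scalePart, shiftPart, LieRing.of_associative_ring_bracket, Matrix.mul_apply, hu, hv]

theorem scalePart_of_zero : scalePart K (FreeLieAlgebra.of K 0) = X := by
  simp [scalePart, affineRep_of_zero]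

theorem scalePart_of_one : scalePart K (FreeLieAlgebra.of K 1) = C X * X := by
  simp [scalePart, affineRep_of_one]

theorem shiftPart_of_zero : shiftPart K (FreeLieAlgebra.of K 0) = 0 := by
  simp [shiftPart, affineRep_of_zero]

theorem shiftPart_of_one : shiftPart K (FreeLieAlgebra.of K 1) = 1 := by
  simp [shiftPart, affineRep_of_one]

theorem scalePart_bracketMonomial (p : ℕ × ℕ) :
    scalePart K (bracketMonomial K (FreeLieAlgebra.of K 0) (FreeLieAlgebra.of K 1) p) = 0 := by
  obtain ⟨a, b, h⟩ := exists_bracketMonomial_eq_lie (K := K)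
    (FreeLieAlgebra.of K (0 : Fin 2)) (FreeLieAlgebra.of K 1) p
  rw [h, scalePart_lie]

theorem shiftPart_bracketMonomial (i j : ℕ) :
    shiftPart K (bracketMonomial K (FreeLieAlgebra.of K 0) (FreeLieAlgebra.of K 1) (i, j)) =
      monomial (i + j + 1) (X ^ j) := by
  suffices h : shiftPart K
      (bracketMonomial K (FreeLieAlgebra.of K 0) (FreeLieAlgebra.of K 1) (i, j)) =
        C (X ^ j) * X ^ (i + j + 1) by rw [h, C_mul_X_pow_eq_monomial]
  induction i with
  | zero =>
    induction j with
    | zero =>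
      simp [bracketMonomial_zero_zero, shiftPart_lie, scalePart_of_zero, shiftPart_of_zero,
        shiftPart_of_one]
    | succ j ih =>
      rw [bracketMonomial_zero_succ, shiftPart_lie, ih, scalePart_bracketMonomial,
        scalePart_of_one]
      simp only [C_pow]
      ring
  | succ i ih =>
    rw [bracketMonomial_succ_fst, shiftPart_lie, ih, scalePart_bracketMonomial, scalePart_of_zero]
    ring

/-- The ideal of elements of the free Lie algebra represented by a matrix whose only nonzero entry
is the top right one and is divisible by `s ^ k`. -/
noncomputable def shiftIdeal (K : Type*) [Field K] (k : ℕ) :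
    LieIdeal K (FreeLieAlgebra K (Fin 2)) where
  carrier := {u | scalePart K u = 0 ∧ X ^ k ∣ shiftPart K u}
  zero_mem' := by simp
  add_mem' := by
    rintro a b ⟨h, h'⟩ ⟨g, g'⟩
    exact ⟨by rw [map_add, h, g, add_zero], by rw [map_add]; exact dvd_add h' g'⟩
  smul_mem' := by
    rintro r a ⟨h, h'⟩
    refine ⟨by rw [map_smul, h, smul_zero], ?_⟩
    rw [map_smul, Algebra.smul_def]
    exact h'.mul_left _
  lie_mem := by
    rintro a u ⟨h, h'⟩
    refine ⟨scalePart_lie a u, ?_⟩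
    rw [shiftPart_lie, h, zero_mul, sub_zero]
    exact h'.mul_left _

theorem lie_mem_shiftIdeal_succ (a : FreeLieAlgebra K (Fin 2)) {u : FreeLieAlgebra K (Fin 2)}
    {k : ℕ} (hu : u ∈ shiftIdeal K k) : ⁅a, u⁆ ∈ shiftIdeal K (k + 1) := by
  refine ⟨scalePart_lie a u, ?_⟩
  rw [shiftPart_lie, hu.1, zero_mul, sub_zero, pow_succ']
  exact mul_dvd_mul (X_dvd_scalePart a) hu.2

theorem lie_mem_shiftIdeal_one (a b : FreeLieAlgebra K (Fin 2)) : ⁅a, b⁆ ∈ shiftIdeal K 1 := by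
  refine ⟨scalePart_lie a b, ?_⟩
  rw [shiftPart_lie, pow_one]
  exact dvd_sub ((X_dvd_scalePart a).mul_right _) ((X_dvd_scalePart b).mul_right _)

theorem lowerCentralSeries_succ_le_shiftIdeal (k : ℕ) :
    LieModule.lowerCentralSeries K (FreeLieAlgebra K (Fin 2)) (FreeLieAlgebra K (Fin 2)) (k + 1) ≤
      shiftIdeal K (k + 1) := by
  induction k with
  | zero =>
    rw [LieModule.lowerCentralSeries_succ, LieSubmodule.lie_le_iff]
    exact fun a _ b _ => lie_mem_shiftIdeal_one a b
  | succ k ih =>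
    rw [LieModule.lowerCentralSeries_succ, LieSubmodule.lie_le_iff]
    exact fun a _ b hb => lie_mem_shiftIdeal_succ a (ih hb)

theorem derivedSeries_two_le_shiftIdeal (k : ℕ) :
    LieAlgebra.derivedSeries K (FreeLieAlgebra K (Fin 2)) 2 ≤ shiftIdeal K k := by
  have h1 : LieAlgebra.derivedSeries K (FreeLieAlgebra K (Fin 2)) 1 ≤ shiftIdeal K 1 := by
    rw [LieAlgebra.derivedSeries_def, LieAlgebra.derivedSeriesOfIdeal_succ,
      LieSubmodule.lie_le_iff]
    exact fun a _ b _ => lie_mem_shiftIdeal_one a b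
  rw [LieAlgebra.derivedSeries_def, LieAlgebra.derivedSeriesOfIdeal_succ,
    LieSubmodule.lie_le_iff]
  intro a ha b hb
  refine ⟨scalePart_lie a b, ?_⟩
  rw [shiftPart_lie, (h1 ha).1, (h1 hb).1]
  simp

theorem X_pow_dvd_shiftPart {c : ℕ} {u : FreeLieAlgebra K (Fin 2)}
    (hu : u ∈ metabelianNilpotentIdeal K c) : X ^ c ∣ shiftPart K u := by
  cases c with
  | zero => simp
  | succ c =>
    exact (sup_le (derivedSeries_two_le_shiftIdeal (c + 1))
      (lowerCentralSeries_succ_le_shiftIdeal c) hu).2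

end AffineRep

/-! ### The free metabelian nilpotent Lie algebra -/

section FreeMetabelianNilpotent

variable (K : Type*) [Field K] (c : ℕ)

/-- The projection of the free Lie algebra onto `FreeMetabelianNilpotent K c`, as a morphism of
Lie algebras. -/
noncomputable def toFreeMetabelianNilpotent :
    FreeLieAlgebra K (Fin 2) →ₗ⁅K⁆ FreeMetabelianNilpotent K c :=
  { (LieSubmodule.Quotient.mk' (metabelianNilpotentIdeal K c) :
      FreeLieAlgebra K (Fin 2) →ₗ[K] FreeMetabelianNilpotent K c) with
    map_lie' := fun {a b} => LieSubmodule.Quotient.mk_bracket _ a b }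

theorem toFreeMetabelianNilpotent_surjective :
    Function.Surjective (toFreeMetabelianNilpotent K c) :=
  LieSubmodule.Quotient.surjective_mk' _

variable {K c}

theorem toFreeMetabelianNilpotent_eq_zero {u : FreeLieAlgebra K (Fin 2)} :
    toFreeMetabelianNilpotent K c u = 0 ↔ u ∈ metabelianNilpotentIdeal K c :=
  LieSubmodule.Quotient.mk_eq_zero _

theorem FreeMetabelianNilpotent.lie_lie_lie_eq_zero (a b d e : FreeMetabelianNilpotent K c) :
    ⁅⁅a, b⁆, ⁅d, e⁆⁆ = 0 := by
  obtain ⟨a, rfl⟩ := toFreeMetabelianNilpotent_surjective K c a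
  obtain ⟨b, rfl⟩ := toFreeMetabelianNilpotent_surjective K c b
  obtain ⟨d, rfl⟩ := toFreeMetabelianNilpotent_surjective K c d
  obtain ⟨e, rfl⟩ := toFreeMetabelianNilpotent_surjective K c e
  simp only [← LieHom.map_lie, toFreeMetabelianNilpotent_eq_zero]
  have h1 (u v : FreeLieAlgebra K (Fin 2)) :
      ⁅u, v⁆ ∈ LieAlgebra.derivedSeries K (FreeLieAlgebra K (Fin 2)) 1 := by
    rw [LieAlgebra.derivedSeries_def, LieAlgebra.derivedSeriesOfIdeal_succ]
    exact LieSubmodule.lie_mem_lie (LieSubmodule.mem_top u) (LieSubmodule.mem_top v)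
  apply LieSubmodule.mem_sup_left
  rw [LieAlgebra.derivedSeries_def, LieAlgebra.derivedSeriesOfIdeal_succ]
  exact LieSubmodule.lie_mem_lie (h1 a b) (h1 d e)

variable (K c) in
theorem FreeMetabelianNilpotent.lieSpan_generators :
    LieSubalgebra.lieSpan K (FreeMetabelianNilpotent K c)
      {toFreeMetabelianNilpotent K c (FreeLieAlgebra.of K 0),
        toFreeMetabelianNilpotent K c (FreeLieAlgebra.of K 1)} = ⊤ := by
  have h := LieSubalgebra.map_lieSpan (f := toFreeMetabelianNilpotent K c)
    (s := Set.range (FreeLieAlgebra.of K))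
  rw [FreeLieAlgebra.lieSpan_range_of, ← LieHom.range_eq_map,
    (LieHom.range_eq_top _).2 (toFreeMetabelianNilpotent_surjective K c)] at h
  rw [h, ← Set.range_comp]
  congr 1
  ext u
  simp [Fin.exists_fin_two, eq_comm]

/-- Monomials of degree greater than `c` vanish in the `c`-step nilpotent algebra. -/
theorem bracketMonomial_eq_zero {i j : ℕ} (h : c ≤ i + j + 1) :
    bracketMonomial K (toFreeMetabelianNilpotent K c (FreeLieAlgebra.of K 0))
      (toFreeMetabelianNilpotent K c (FreeLieAlgebra.of K 1)) (i, j) = 0 := by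
  rw [← map_bracketMonomial, toFreeMetabelianNilpotent_eq_zero]
  exact LieSubmodule.mem_sup_right (LieModule.antitone_lowerCentralSeries K _ _ h
    (bracketMonomial_mem_lowerCentralSeries _ _ i j))

theorem scalePart_linearCombination (f : ℕ × ℕ →₀ K) :
    scalePart K (Finsupp.linearCombination K
      (bracketMonomial K (FreeLieAlgebra.of K 0) (FreeLieAlgebra.of K 1)) f) = 0 := by
  simp [Finsupp.linearCombination_apply, Finsupp.sum, map_sum, scalePart_bracketMonomial]

/-- The affine representation separates the monomials: the coefficients of a combination can be read
off from its top right entry. -/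
theorem coeff_coeff_shiftPart_linearCombination (f : ℕ × ℕ →₀ K) (i j : ℕ) :
    ((shiftPart K (Finsupp.linearCombination K
      (bracketMonomial K (FreeLieAlgebra.of K 0) (FreeLieAlgebra.of K 1)) f)).coeff
        (i + j + 1)).coeff j = f (i, j) := by
  have h (p : ℕ × ℕ) : (((f p • shiftPart K (bracketMonomial K (FreeLieAlgebra.of K 0)
      (FreeLieAlgebra.of K 1) p)).coeff (i + j + 1)).coeff j) = if p = (i, j) then f p else 0 := by
    obtain ⟨a, b⟩ := p
    rw [shiftPart_bracketMonomial, coeff_smul, coeff_monomial]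
    by_cases hab : (a, b) = (i, j)
    · obtain ⟨rfl, rfl⟩ := Prod.mk.inj hab
      simp
    · rw [if_neg hab]
      split_ifs with h1
      · rw [coeff_smul, coeff_X_pow, if_neg, smul_zero]
        rintro rfl
        exact hab (by simpa using h1)
      · simp
  simp only [Finsupp.linearCombination_apply, Finsupp.sum, map_sum, map_smul, finsetSum_coeff, h]
  rw [Finset.sum_ite_eq']
  split_ifs with h0
  · rfl
  · exact (Finsupp.notMem_support_iff.1 h0).symm

/-- If `u` is a combination of monomials and `⁅u, t y⁆ ∈ [𝔪, x + t y]` for every `t`, then the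
monomials of `u` that `ad y` does not kill in `𝔪` have coefficient zero. For the part `P ∈ K[z]` of
`shiftPart K u` in a fixed degree, the hypothesis says that `t z P` is a multiple of `1 + t z`.
Taking `t = -ζ⁻¹` gives `P(ζ) = 0` for each of the infinitely many `ζ ≠ 0`. -/
theorem coeff_eq_zero_of_lie_smul_eq_lie_add_smul [Infinite K] {f : ℕ × ℕ →₀ K}
    (hf : ∀ t : K, ∃ w : FreeLieAlgebra K (Fin 2),
      t • ⁅Finsupp.linearCombination K
          (bracketMonomial K (FreeLieAlgebra.of K (0 : Fin 2)) (FreeLieAlgebra.of K 1)) f,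
          FreeLieAlgebra.of K 1⁆ -
        ⁅w, FreeLieAlgebra.of K 0 + t • FreeLieAlgebra.of K 1⁆ ∈ metabelianNilpotentIdeal K c)
    {i j : ℕ} (hij : i + j + 2 < c) : f (i, j) = 0 := by
  rw [← coeff_coeff_shiftPart_linearCombination f i j]
  -- The monomial with exponents `(i, j)` sits in degree `i + j + 1` of the polynomial in `s`.
  set u := Finsupp.linearCombination K
    (bracketMonomial K (FreeLieAlgebra.of K (0 : Fin 2)) (FreeLieAlgebra.of K 1)) f with hu
  set P := (shiftPart K u).coeff (i + j + 1) with hP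
  suffices h : P = 0 by rw [h, coeff_zero]
  refine eq_zero_of_infinite_isRoot P ((Set.finite_singleton (0 : K)).infinite_compl.mono ?_)
  intro ζ hζ
  have hζ0 : ζ ≠ 0 := hζ
  obtain ⟨w, hw⟩ := hf (-ζ⁻¹)
  -- In degree `i + j + 2 ≥ 2` the contribution of `scalePart K w` vanishes as well.
  have h := (X_pow_dvd_iff.1 (X_pow_dvd_shiftPart hw)) (i + j + 2) hij
  have hA : (scalePart K w).coeff (i + j + 2) = 0 := coeff_scalePart w (by omega)
  simp only [map_sub, map_smul, map_add, shiftPart_lie, scalePart_of_zero, scalePart_of_one,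
    shiftPart_of_zero, shiftPart_of_one, scalePart_linearCombination, hu, zero_add] at h
  rw [← hu] at h
  simp only [zero_sub, mul_assoc, add_mul, smul_mul_assoc, mul_smul_comm, mul_one,
    coeff_sub, coeff_add, coeff_smul, coeff_neg, coeff_C_mul, coeff_X_mul, hA, smul_zero,
    ← hP] at h
  have h' := congrArg (eval ζ) h
  simp only [eval_sub, eval_add, eval_smul, eval_neg, eval_mul, eval_X, eval_zero,
    smul_eq_mul] at h'
  rw [Set.mem_ofPred_eq, IsRoot.def]
  field_simp at h'
  linear_combination h'

/-- An almost inner derivation killing `x` and mapping `y` to `⁅u, y⁆`, where `u` is a combination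
of monomials, also kills `y`. -/
theorem lie_generator_eq_zero_of_isAlmostInner [Infinite K]
    {D : LieDerivation K (FreeMetabelianNilpotent K c) (FreeMetabelianNilpotent K c)}
    (hD : IsAlmostInner D) {f : ℕ × ℕ →₀ K}
    (h0 : D (toFreeMetabelianNilpotent K c (FreeLieAlgebra.of K 0)) = 0)
    (h1 : D (toFreeMetabelianNilpotent K c (FreeLieAlgebra.of K 1)) =
      ⁅Finsupp.linearCombination K
        (bracketMonomial K (toFreeMetabelianNilpotent K c (FreeLieAlgebra.of K 0))
          (toFreeMetabelianNilpotent K c (FreeLieAlgebra.of K 1))) f,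
        toFreeMetabelianNilpotent K c (FreeLieAlgebra.of K 1)⁆) :
    D (toFreeMetabelianNilpotent K c (FreeLieAlgebra.of K 1)) = 0 := by
  have hf {i j : ℕ} (hij : i + j + 2 < c) : f (i, j) = 0 := by
    refine coeff_eq_zero_of_lie_smul_eq_lie_add_smul (c := c) (fun t => ?_) hij
    obtain ⟨z, hz⟩ := hD (toFreeMetabelianNilpotent K c
      (FreeLieAlgebra.of K 0 + t • FreeLieAlgebra.of K 1))
    obtain ⟨z, rfl⟩ := toFreeMetabelianNilpotent_surjective K c z
    refine ⟨z, ?_⟩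
    rw [← toFreeMetabelianNilpotent_eq_zero, map_sub, LieHom.map_lie _ z, ← hz,
      map_smul, LieHom.map_lie, map_add, map_smul, map_add, map_smul, h0, h1,
      zero_add, sub_eq_zero]
    congr 2
    simp only [Finsupp.linearCombination_apply, Finsupp.sum, map_sum, map_smul,
      map_bracketMonomial]
  rw [h1, Finsupp.linearCombination_apply, Finsupp.sum, sum_lie]
  refine Finset.sum_eq_zero fun p _ => ?_
  obtain ⟨i, j⟩ := p
  by_cases hij : i + j + 2 < c
  · rw [hf hij, zero_smul, zero_lie]
  · rw [smul_lie, ← lie_skew, ← bracketMonomial_succ_snd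
      FreeMetabelianNilpotent.lie_lie_lie_eq_zero, bracketMonomial_eq_zero (by omega), neg_zero,
      smul_zero]

end FreeMetabelianNilpotent

/-! ### Almost inner derivations -/

theorem Inn_le_AID (K L : Type*) [CommRing K] [LieRing L] [LieAlgebra K L] :
    Inn K L ≤ AID K L := by
  rintro _ ⟨u, rfl⟩ x
  exact ⟨u, by simp⟩

theorem proposition6p3 (K : Type*) [Field K] [Infinite K] (c : ℕ) :
    AID K (FreeMetabelianNilpotent K c) = Inn K (FreeMetabelianNilpotent K c) := by
  refine le_antisymm (fun D hD => ?_) (Inn_le_AID K _)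
  set x := toFreeMetabelianNilpotent K c (FreeLieAlgebra.of K 0) with hx
  set y := toFreeMetabelianNilpotent K c (FreeLieAlgebra.of K 1) with hy
  obtain ⟨u, hu⟩ := hD x
  obtain ⟨v, hv⟩ := hD y
  obtain ⟨a, b, f, hf⟩ := exists_eq_add_linearCombination_bracketMonomial
    FreeMetabelianNilpotent.lie_lie_lie_eq_zero
    (FreeMetabelianNilpotent.lieSpan_generators K c) (v - u)
  have hv' : v = u + (a • x + b • y + Finsupp.linearCombination K (bracketMonomial K x y) f) := by
    rw [← hf]; abel
  -- `ad (a • x)` kills `x` and absorbs the part of `v - u` outside the monomials: `⁅b • y, y⁆ = 0`.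
  have had : LieDerivation.ad K _ (u + a • x) ∈ Inn K (FreeMetabelianNilpotent K c) := ⟨_, rfl⟩
  have hsub : D - LieDerivation.ad K _ (u + a • x) = 0 := by
    have hD' : IsAlmostInner (D - LieDerivation.ad K _ (u + a • x)) :=
      sub_mem (S := LieSubalgebra K _) hD (Inn_le_AID K _ had)
    have h0 : (D - LieDerivation.ad K _ (u + a • x)) x = 0 := by
      simp [hu]
    have h1 : (D - LieDerivation.ad K _ (u + a • x)) y =
        ⁅Finsupp.linearCombination K (bracketMonomial K x y) f, y⁆ := by
      simp [hv, hv']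
    refine LieDerivation.ext_of_lieSpan_eq_top _
      (FreeMetabelianNilpotent.lieSpan_generators K c) ?_
    rintro _ (rfl | rfl)
    · exact h0
    · exact lie_generator_eq_zero_of_isAlmostInner hD' h0 h1
  rw [sub_eq_zero.1 hsub]
  exact had
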